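/- Let $Y\ge 0$ be a random variable that is absolutely continuous with density $g$ on $(0,\infty)$. Suppose that for some $a>1$ the function $g$ is continuous and strictly positive on $[a,\infty)$, that $$\int_a^\infty \frac{-\ln g(x^2)}{x^2\ln x}\,dx=\infty,$$ and that $-\ln g(x)/\ln x$ is nondecreasing on $[a,\infty)$ and tends to $\infty$ as $x\to\infty$. Write $g(x)=\exp[-u(x)\ln x]$ for $x\ge a$. Let $v:(0,\infty)\to\mathbb R$ be measurable with $v(x)\ge u(x)$ for all $x\ge a$, and let $Y_*$ be a random variable with density $g_*(x)=c_*\exp[-v(x)\ln x]$, $x>0$, where $c_*>0$ is the normalizing constant. Then all moments of $Y$ and $Y_*$ are finite, and there is a constant $C>0$ such that $$\mathbf E[Y_*^n]\le C\,\mathbf E[Y^n]\qquad\text{for all integers } n\ge 0.$$ Moreover, $Y_*$ satisfies Carleman's condition (Stieltjes case) $\sum_{k=1}^\infty \big(\mathbf E[Y_*^k]\big)^{-1/(2k)}=\infty$, and $Y_*$ is moment-determinate: its law is the only probability distribution on $[0,\infty)$ with all moments finite and equal to $\mathbf E[Y_*^k]$, $k=1,2,\ldots$. -/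

import Mathlib

open MeasureTheory ProbabilityTheory Filter
open scoped ENNReal Topology

/-- The random variable `X` takes values in the half-line `[0, ∞)` and is absolutely continuous
with density `f` there (only the values of `f` on `(0, ∞)` matter). -/
structure HasHalfLineDensity {Ω : Type*} [MeasurableSpace Ω] (X : Ω → ℝ) (f : ℝ → ℝ)
    (P : Measure Ω) : Prop where
  measurable : Measurable fun x : Set.Ioi (0 : ℝ) => f x
  nonneg : ∀ x : ℝ, 0 < x → 0 ≤ f x
  hasLaw : HasLaw X
    ((volume.restrict (Set.Ioi (0 : ℝ))).withDensity fun x => ENNReal.ofReal (f x)) P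

/-- `∫_a^∞ (-ln g(x²)) / (x² ln x) dx = ∞`, as an improper integral. It is used only for `a > 1` and
`g` continuous and positive on `[a, ∞)`, so that the integrand is continuous on `[a, ∞)`. -/
def KStarDiverges (g : ℝ → ℝ) (a : ℝ) : Prop :=
  Tendsto (fun R : ℝ => ∫ x in a..R, -Real.log (g (x ^ 2)) / (x ^ 2 * Real.log x)) atTop atTop

/-- The analytic conditions on a density `g` on the half-line, with threshold `a > 1`: `g` is
continuous and strictly positive on `[a, ∞)`, the integral `K_*[g]` diverges, and
`-ln g(x) / ln x` increases (weakly) to infinity on `[a, ∞)`. -/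
structure StieltjesDensityConditions (g : ℝ → ℝ) (a : ℝ) : Prop where
  one_lt : 1 < a
  continuousOn : ContinuousOn g (Set.Ici a)
  pos : ∀ x : ℝ, a ≤ x → 0 < g x
  kStar : KStarDiverges g a
  monotoneOn : MonotoneOn (fun x : ℝ => -Real.log (g x) / Real.log x) (Set.Ici a)
  tendsto : Tendsto (fun x : ℝ => -Real.log (g x) / Real.log x) atTop atTop

/-- Carleman's condition in the Stieltjes case: `X ≥ 0` almost surely, all moments
`m_k = E[X^k]` are finite, and `∑_{k ≥ 1} m_k ^ (-1/(2k)) = ∞`.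
The sum is taken in `[0, ∞]`, where `0 ^ (-1/(2k)) = ∞`. -/
structure StieltjesCarleman {Ω : Type*} [MeasurableSpace Ω] (X : Ω → ℝ) (P : Measure Ω) :
    Prop where
  nonneg : ∀ᵐ ω ∂P, 0 ≤ X ω
  integrable : ∀ k : ℕ, Integrable (fun ω => X ω ^ k) P
  sum_eq_top : ∑' k : ℕ,
    (ENNReal.ofReal (moment X (k + 1) P)) ^ (-(1 / (2 * ((k : ℝ) + 1)))) = ⊤

/-- A distribution `ν` on `[0, ∞)` with finite moments is moment-determinate (Stieltjes case)
if it is the only probability distribution on `[0, ∞)` with its moments. -/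
structure StieltjesMDeterminate (ν : Measure ℝ) : Prop where
  nonneg : ν (Set.Iio 0) = 0
  integrable : ∀ k : ℕ, Integrable (fun x : ℝ => x ^ k) ν
  unique : ∀ ν' : Measure ℝ, IsProbabilityMeasure ν' → ν' (Set.Iio 0) = 0 →
    (∀ k : ℕ, Integrable (fun x : ℝ => x ^ k) ν') →
    (∀ k : ℕ, 1 ≤ k → ∫ x, x ^ k ∂ν' = ∫ x, x ^ k ∂ν) → ν' = ν

/-! ### Carleman's inequality -/

/-! Write `U = -ln g / ln`, which equals `u` on `[a, ∞)`. Since `v ≥ u` there, the density of `Y_*`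
is at most `c x ^ (-U x)`; only this domination enters, so `v` needs no monotonicity. Comparing the
two densities beyond `a`, and `a ^ n` with `E[Y ^ n]` below it, gives the moment inequality.

For Carleman's condition, let `s k` be the point where `x ↦ U (x ^ 2)` passes the level `k + 3`.
Beyond `s k ^ 2` the density is at most `c / x ^ (k + 3)`, so the moment of order `k + 1` is at most
`(1 + c) s k ^ (2 (k + 1))`, and the corresponding Carleman term is at least a constant times `1 / s
k`. Counting levels under the integral shows that `∫ U (x ^ 2) / x ^ 2 = ∞` forces `∑ 1 / s k = ∞`
(`exists_passage_seq`).

Determinacy follows from Carleman's condition through quasi-analyticity. Taking symmetrised square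
roots reduces the half-line problem to the line. There, the difference of two characteristic
functions with the same moments has all derivatives zero at `0`, and its `n`-th derivative is
bounded by the sum `M n` of absolute moments, a log-convex sequence. Carleman's inequality
(`Summable.geom_mean`) turns divergence of `∑ (M n) ^ (-1/n)` into divergence of `∑ M n / M (n +
1)`, and Bang's argument (`norm_le_of_bang_step`) then makes the difference vanish. -/

theorem add_one_div_exp_pow_le_factorial (n : ℕ) :
    (((n : ℝ) + 1) / Real.exp 1) ^ n ≤ (n.factorial : ℝ) := by
  induction n with
  | zero => simp
  | succ n ih =>
    have hpos : (0 : ℝ) < (n : ℝ) + 1 := by positivity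
    have h1 : (((n : ℝ) + 2) / (n + 1)) ^ (n + 1) ≤ Real.exp 1 := by
      have h2 : ((n : ℝ) + 2) / (n + 1) ≤ Real.exp (1 / (n + 1)) := by
        have := Real.add_one_le_exp (1 / ((n : ℝ) + 1))
        calc ((n : ℝ) + 2) / (n + 1) = 1 / (n + 1) + 1 := by field_simp; ring
          _ ≤ _ := this
      calc (((n : ℝ) + 2) / (n + 1)) ^ (n + 1) ≤ (Real.exp (1 / (n + 1))) ^ (n + 1) := by
            gcongr
        _ = Real.exp 1 := by
            rw [← Real.exp_nat_mul]
            congr 1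
            push_cast
            field_simp
    have he : (0 : ℝ) < Real.exp 1 := Real.exp_pos 1
    rw [Nat.factorial_succ]
    push_cast
    calc (((n : ℝ) + 1 + 1) / Real.exp 1) ^ (n + 1)
        = (((n : ℝ) + 2) / (n + 1)) ^ (n + 1) / Real.exp 1 *
          ((n + 1) * (((n : ℝ) + 1) / Real.exp 1) ^ n) := by
            rw [div_pow, div_pow, div_pow]
            field_simp
            ring
      _ ≤ 1 * ((n + 1) * (n.factorial : ℝ)) := by
            gcongr
            exact (div_le_one he).2 h1
      _ = _ := one_mul _

/-- The geometric mean of `a 0, …, a n` is controlled by a weighted arithmetic mean. -/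
theorem geom_mean_le_weighted_sum {a : ℕ → ℝ} (ha : ∀ n, 0 ≤ a n) (n : ℕ) :
    (∏ i ∈ Finset.range (n + 1), a i) ^ (1 / ((n : ℝ) + 1)) ≤
      Real.exp 1 * ((∑ i ∈ Finset.range (n + 1), ((i : ℝ) + 1) * a i) /
        (((n : ℝ) + 1) * (n + 2))) := by
  have hn : (0 : ℝ) < (n : ℝ) + 1 := by positivity
  have he : (0 : ℝ) < Real.exp 1 := Real.exp_pos 1
  have hprod : 0 ≤ ∏ i ∈ Finset.range (n + 1), a i := Finset.prod_nonneg fun i _ => ha i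
  have hfac : (((n + 1).factorial : ℕ) : ℝ) = ∏ i ∈ Finset.range (n + 1), ((i : ℝ) + 1) := by
    rw [← Finset.prod_range_add_one_eq_factorial]
    push_cast
    rfl
  -- AM-GM is applied to `(i + 1) a i`: the weights multiply to `(n + 1)!`, whose root of order `n +
  -- 1` is at least `(n + 2) / e`. This yields the denominator `(n + 1) (n + 2)`, which telescopes
  -- on summation.
  have h1 : (∏ i ∈ Finset.range (n + 1), (((i : ℝ) + 1) * a i)) ^ (1 / ((n : ℝ) + 1)) ≤
      (∑ i ∈ Finset.range (n + 1), ((i : ℝ) + 1) * a i) / ((n : ℝ) + 1) := by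
    have h := Real.geom_mean_le_arith_mean (Finset.range (n + 1)) (fun _ => (1 : ℝ))
      (fun i => ((i : ℝ) + 1) * a i) (fun _ _ => zero_le_one) (by simp; positivity)
      (fun i _ => mul_nonneg (by positivity) (ha i))
    simpa using h
  have h2 : ((n : ℝ) + 2) / Real.exp 1 ≤ ((n + 1).factorial : ℝ) ^ (1 / ((n : ℝ) + 1)) := by
    have h := add_one_div_exp_pow_le_factorial (n + 1)
    have h' := Real.rpow_le_rpow (by positivity) h (z := 1 / ((n : ℝ) + 1)) (by positivity)
    rw [← Real.rpow_natCast, ← Real.rpow_mul (by positivity)] at h'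
    push_cast at h'
    rw [mul_one_div_cancel hn.ne', Real.rpow_one] at h'
    calc ((n : ℝ) + 2) / Real.exp 1 = ((n : ℝ) + 1 + 1) / Real.exp 1 := by ring
      _ ≤ _ := h'
  rw [Finset.prod_mul_distrib, ← hfac, Real.mul_rpow (by positivity) hprod] at h1
  set G := (∏ i ∈ Finset.range (n + 1), a i) ^ (1 / ((n : ℝ) + 1))
  have hG : 0 ≤ G := Real.rpow_nonneg hprod _
  have h3 := (mul_le_mul_of_nonneg_right h2 hG).trans h1
  rw [div_mul_eq_mul_div, div_le_div_iff₀ he hn] at h3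
  rw [mul_div_assoc', le_div_iff₀ (by positivity)]
  nlinarith

/-- **Carleman's inequality**, in qualitative form: the geometric means of a summable sequence
are summable. -/
theorem Summable.geom_mean {a : ℕ → ℝ} (ha : ∀ n, 0 ≤ a n) (hs : Summable a) :
    Summable fun n : ℕ => (∏ i ∈ Finset.range (n + 1), a i) ^ (1 / ((n : ℝ) + 1)) := by
  -- Summation by parts with `1 / ((n + 1) (n + 2)) = 1 / (n + 1) - 1 / (n + 2)`; the boundary term
  -- is nonnegative and can be dropped.
  have key : ∀ N : ℕ, ∑ n ∈ Finset.range N, (∑ i ∈ Finset.range (n + 1), ((i : ℝ) + 1) * a i) /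
        (((n : ℝ) + 1) * (n + 2)) +
      (∑ i ∈ Finset.range N, ((i : ℝ) + 1) * a i) / ((N : ℝ) + 1) =
        ∑ n ∈ Finset.range N, a n := by
    intro N
    induction N with
    | zero => simp
    | succ N ih =>
      rw [Finset.sum_range_succ (fun n => a n), ← ih, Finset.sum_range_succ (fun n : ℕ =>
        (∑ i ∈ Finset.range (n + 1), ((i : ℝ) + 1) * a i) / (((n : ℝ) + 1) * (n + 2))),
        Finset.sum_range_succ (fun i : ℕ => ((i : ℝ) + 1) * a i) N]
      push_cast
      field_simp
      ring
  refine summable_of_sum_range_le (c := Real.exp 1 * ∑' n, a n)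
    (fun n => Real.rpow_nonneg (Finset.prod_nonneg fun i _ => ha i) _) fun N => ?_
  calc ∑ n ∈ Finset.range N, (∏ i ∈ Finset.range (n + 1), a i) ^ (1 / ((n : ℝ) + 1))
      ≤ ∑ n ∈ Finset.range N, Real.exp 1 *
        ((∑ i ∈ Finset.range (n + 1), ((i : ℝ) + 1) * a i) / (((n : ℝ) + 1) * (n + 2))) :=
        Finset.sum_le_sum fun n _ => geom_mean_le_weighted_sum ha n
    _ = Real.exp 1 * ∑ n ∈ Finset.range N,
        (∑ i ∈ Finset.range (n + 1), ((i : ℝ) + 1) * a i) / (((n : ℝ) + 1) * (n + 2)) := by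
        rw [Finset.mul_sum]
    _ ≤ Real.exp 1 * ∑ n ∈ Finset.range N, a n := by
        refine mul_le_mul_of_nonneg_left ?_ (Real.exp_pos 1).le
        rw [← key N]
        exact le_add_of_nonneg_right (div_nonneg (Finset.sum_nonneg fun i _ =>
          mul_nonneg (by positivity) (ha i)) (by positivity))
    _ ≤ Real.exp 1 * ∑' n, a n := by
        gcongr
        exact hs.sum_le_tsum _ fun i _ => ha i

/-- If `∑ (M n) ^ (-1/n)` diverges, then so does `∑ M n / M (n + 1)`. -/
theorem summable_rpow_neg_inv_of_summable_ratio {M : ℕ → ℝ} (hM : ∀ n, 0 < M n)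
    (hs : Summable fun n => M n / M (n + 1)) :
    Summable fun n : ℕ => M (n + 1) ^ (-(1 / ((n : ℝ) + 1))) := by
  have hprod : ∀ n, ∏ i ∈ Finset.range n, M i / M (i + 1) = M 0 / M n := by
    intro n
    induction n with
    | zero => simp [(hM 0).ne']
    | succ n ih =>
      rw [Finset.prod_range_succ, ih]
      have := (hM n).ne'
      field_simp
  -- The products of ratios telescope to `M 0 / M n`. The factor `max 1 (M 0)⁻¹` bounds `(M 0) ^
  -- (-1/(n+1))` uniformly in `n`.
  have h := (Summable.geom_mean (fun n => (div_pos (hM n) (hM (n + 1))).le) hs).mul_left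
    (max 1 (M 0)⁻¹)
  refine h.of_nonneg_of_le (fun n => Real.rpow_nonneg (hM _).le _) fun n => ?_
  have hn : (0 : ℝ) < (n : ℝ) + 1 := by positivity
  rw [hprod, div_eq_mul_inv (M 0), Real.mul_rpow (hM 0).le (inv_pos.2 (hM _)).le,
    Real.rpow_neg (hM _).le, Real.inv_rpow (hM _).le, ← mul_assoc]
  refine le_mul_of_one_le_left (inv_nonneg.2 (Real.rpow_nonneg (hM _).le _)) ?_
  have hp : 0 < M 0 ^ (1 / ((n : ℝ) + 1)) := Real.rpow_pos_of_pos (hM 0) _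
  rw [← div_le_iff₀ hp, one_div, ← Real.inv_rpow (hM 0).le]
  calc ((M 0)⁻¹) ^ (1 / ((n : ℝ) + 1)) ≤ (max 1 (M 0)⁻¹) ^ (1 / ((n : ℝ) + 1)) :=
        Real.rpow_le_rpow (inv_pos.2 (hM 0)).le (le_max_right _ _) (by positivity)
    _ ≤ (max 1 (M 0)⁻¹) ^ (1 : ℝ) := by
        refine Real.rpow_le_rpow_of_exponent_le (le_max_left _ _) ?_
        rw [div_le_one hn]
        linarith [Nat.cast_nonneg (α := ℝ) n]
    _ = _ := Real.rpow_one _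

/-! ### The Denjoy–Carleman theorem, following Bang -/

section Bang

variable {E : Type*} [NormedAddCommGroup E] [NormedSpace ℝ E]

/-- One step of Bang's argument: the bounds of level `k + 1` at `x` yield those of level `k` on an
interval to the right of `x`. -/
theorem norm_le_of_bang_step {F : ℕ → ℝ → E} {M : ℕ → ℝ}
    (hF : ∀ n t, HasDerivAt (F n) (F (n + 1) t) t) (hM : ∀ n, 0 < M n)
    (hMF : ∀ n t, ‖F n t‖ ≤ M n) (hconv : ∀ n, M (n + 1) ^ 2 ≤ M n * M (n + 2))
    {k : ℕ} {x y : ℝ} (hx : ∀ j : ℕ, ‖F j x‖ ≤ Real.exp ((j : ℝ) - (k + 1 : ℕ)) * M j)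
    (hxy : x ≤ y) (hy : y ≤ x + M k / (Real.exp 1 * M (k + 1))) (j : ℕ) :
    ‖F j y‖ ≤ Real.exp ((j : ℝ) - k) * M j := by
  have hratio : Monotone fun n => M (n + 1) / M n := by
    refine monotone_nat_of_le_succ fun n => ?_
    rw [div_le_div_iff₀ (hM _) (hM _)]
    nlinarith [hconv n]
  set q := M (k + 1) / M k with hq
  have hqpos : 0 < q := div_pos (hM _) (hM _)
  have hr : ∀ i, i ≤ k → M (i + 1) ≤ q * M i := fun i hi => by
    rw [← div_le_iff₀ (hM i)]
    exact hratio hi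
  set L := Real.exp 1 * q with hL
  have hLpos : 0 < L := by positivity
  -- Downward induction on `j` from `k + 1`, where the global bound suffices. Below, the majorant of
  -- `F j` grows at least as fast as the majorant of `F (j + 1)` requires, because `L = e q` and
  -- log-convexity gives `M (j + 1) ≤ q M j` for `j ≤ k`.
  have main : ∀ d j : ℕ, j + d = k + 1 → ∀ t, x ≤ t →
      ‖F j t‖ ≤ Real.exp ((j : ℝ) - (k + 1 : ℕ)) * M j * Real.exp (L * (t - x)) := by
    intro d
    induction d with
    | zero =>
      intro j hj t ht
      obtain rfl : j = k + 1 := by omega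
      rw [sub_self, Real.exp_zero, one_mul]
      exact (hMF _ t).trans (le_mul_of_one_le_right (hM _).le
        (Real.one_le_exp (mul_nonneg hLpos.le (sub_nonneg.2 ht))))
    | succ d ih =>
      intro j hj t ht
      set A := Real.exp ((j : ℝ) - (k + 1 : ℕ)) * M j with hA
      have hB : ∀ s, HasDerivAt (fun s => A * Real.exp (L * (s - x)))
          (A * (Real.exp (L * (s - x)) * L)) s := by
        intro s
        have h1 : HasDerivAt (fun s => L * (s - x)) L s := by
          simpa using ((hasDerivAt_id s).sub_const x).const_mul L
        exact (h1.exp).const_mul A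
      refine image_norm_le_of_norm_deriv_right_le_deriv_boundary (f := F j) (f' := F (j + 1))
        (a := x) (b := t) (fun s _ => (hF j s).continuousAt.continuousWithinAt)
        (fun s _ => (hF j s).hasDerivWithinAt) (by
          simpa only [sub_self, mul_zero, Real.exp_zero, mul_one] using hx j) hB ?_ ⟨ht, le_rfl⟩
      intro s hs
      refine (ih (j + 1) (by omega) s hs.1).trans ?_
      have h2 := hr j (by omega)
      have h3 : Real.exp (((j + 1 : ℕ) : ℝ) - (k + 1 : ℕ)) =
          Real.exp 1 * Real.exp ((j : ℝ) - (k + 1 : ℕ)) := by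
        rw [← Real.exp_add]
        congr 1
        push_cast
        ring
      rw [h3]
      calc Real.exp 1 * Real.exp ((j : ℝ) - (k + 1 : ℕ)) * M (j + 1) * Real.exp (L * (s - x))
          ≤ Real.exp 1 * Real.exp ((j : ℝ) - (k + 1 : ℕ)) * (q * M j) *
            Real.exp (L * (s - x)) := by gcongr
        _ = _ := by rw [hA, hL]; ring
  rcases le_or_gt j k with hj | hj
  · refine (main (k + 1 - j) j (by omega) y hxy).trans ?_
    have h4 : L * (y - x) ≤ 1 := by
      have : y - x ≤ 1 / L := by
        rw [hL, hq, one_div, mul_inv, inv_div]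
        have : M k / (Real.exp 1 * M (k + 1)) = (Real.exp 1)⁻¹ * (M k / M (k + 1)) := by
          field_simp
        linarith
      calc L * (y - x) ≤ L * (1 / L) := by gcongr
        _ = 1 := mul_one_div_cancel hLpos.ne'
    calc Real.exp ((j : ℝ) - (k + 1 : ℕ)) * M j * Real.exp (L * (y - x))
        ≤ Real.exp ((j : ℝ) - (k + 1 : ℕ)) * M j * Real.exp 1 := by
          have := (hM j).le
          gcongr
      _ = Real.exp ((j : ℝ) - (k + 1 : ℕ)) * Real.exp 1 * M j := by ring
      _ = _ := by
          rw [← Real.exp_add]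
          congr 2
          push_cast
          ring
  · refine (hMF j y).trans (le_mul_of_one_le_left (hM j).le (Real.one_le_exp ?_))
    rw [sub_nonneg]
    exact_mod_cast hj.le

theorem norm_le_of_bang_steps {F : ℕ → ℝ → E} {M : ℕ → ℝ}
    (hF : ∀ n t, HasDerivAt (F n) (F (n + 1) t) t) (hM : ∀ n, 0 < M n)
    (hMF : ∀ n t, ‖F n t‖ ≤ M n) (hconv : ∀ n, M (n + 1) ^ 2 ≤ M n * M (n + 2))
    (k n : ℕ) {x y : ℝ} (hx : ∀ j : ℕ, ‖F j x‖ ≤ Real.exp ((j : ℝ) - (k + n : ℕ)) * M j)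
    (hxy : x ≤ y)
    (hy : y ≤ x + ∑ i ∈ Finset.range n, M (k + i) / (Real.exp 1 * M (k + i + 1))) (j : ℕ) :
    ‖F j y‖ ≤ Real.exp ((j : ℝ) - k) * M j := by
  induction n generalizing x with
  | zero =>
    obtain rfl : y = x := le_antisymm (by simpa using hy) hxy
    simpa using hx j
  | succ n ih =>
    rw [Finset.sum_range_succ] at hy
    set δ := M (k + n) / (Real.exp 1 * M (k + n + 1)) with hδ
    have hδpos : 0 < δ := div_pos (hM _) (mul_pos (Real.exp_pos 1) (hM _))
    refine ih (x := min y (x + δ)) (fun i => norm_le_of_bang_step hF hM hMF hconv hx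
      (le_min hxy (le_add_of_nonneg_right hδpos.le)) (min_le_right _ _) i) (min_le_left _ _) ?_
    rcases min_cases y (x + δ) with h | h
    · rw [h.1]
      exact le_add_of_nonneg_right (Finset.sum_nonneg fun i _ =>
        (div_pos (hM _) (mul_pos (Real.exp_pos 1) (hM _))).le)
    · rw [h.1]
      linarith

/-- **Denjoy–Carleman theorem** on a half-line: a smooth function with derivatives `F n`, which
all vanish at `0` and are bounded by a log-convex sequence `M n` with `∑ M n / M (n + 1) = ∞`,
vanishes on `[0, ∞)`. -/
theorem eq_zero_of_denjoyCarleman {F : ℕ → ℝ → E} {M : ℕ → ℝ}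
    (hF : ∀ n t, HasDerivAt (F n) (F (n + 1) t) t) (hM : ∀ n, 0 < M n)
    (hMF : ∀ n t, ‖F n t‖ ≤ M n) (hconv : ∀ n, M (n + 1) ^ 2 ≤ M n * M (n + 2))
    (hdiv : ¬ Summable fun n => M n / M (n + 1)) (h0 : ∀ n, F n 0 = 0) {t : ℝ} (ht : 0 ≤ t) :
    F 0 t = 0 := by
  -- At `0` the bounds hold at every level `k + n`. Each step to the right costs one level, and
  -- divergence lets finitely many steps cover `[0, t]` while ending at level `k`.
  have key : ∀ k : ℕ, ‖F 0 t‖ ≤ Real.exp (-(k : ℝ)) * M 0 := by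
    intro k
    have hdiv' : ¬ Summable fun i => M (k + i) / (Real.exp 1 * M (k + i + 1)) := by
      intro h
      refine hdiv ((summable_nat_add_iff k).1 ?_)
      refine (h.mul_left (Real.exp 1)).congr fun i => ?_
      rw [add_comm i k]
      have := (hM (k + i + 1)).ne'
      field_simp
    have hnn : ∀ i, 0 ≤ M (k + i) / (Real.exp 1 * M (k + i + 1)) := fun i =>
      (div_pos (hM _) (mul_pos (Real.exp_pos 1) (hM _))).le
    rw [not_summable_iff_tendsto_nat_atTop_of_nonneg hnn] at hdiv'
    obtain ⟨n, hn⟩ := (hdiv'.eventually_ge_atTop t).exists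
    have := norm_le_of_bang_steps hF hM hMF hconv k n (x := 0) (y := t)
      (fun j => by rw [h0, norm_zero]; exact mul_nonneg (Real.exp_pos _).le (hM j).le) ht
      (by linarith) 0
    simpa using this
  have hlim : Tendsto (fun k : ℕ => Real.exp (-(k : ℝ)) * M 0) atTop (𝓝 0) := by
    have := (Real.tendsto_exp_neg_atTop_nhds_zero.comp
      (tendsto_natCast_atTop_atTop (R := ℝ))).mul_const (M 0)
    simpa using this
  exact norm_le_zero_iff.1 (ge_of_tendsto' hlim key)

/-- **Denjoy–Carleman theorem** on the line. -/
theorem eq_zero_of_denjoyCarleman_real {F : ℕ → ℝ → E} {M : ℕ → ℝ}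
    (hF : ∀ n t, HasDerivAt (F n) (F (n + 1) t) t) (hM : ∀ n, 0 < M n)
    (hMF : ∀ n t, ‖F n t‖ ≤ M n) (hconv : ∀ n, M (n + 1) ^ 2 ≤ M n * M (n + 2))
    (hdiv : ¬ Summable fun n => M n / M (n + 1)) (h0 : ∀ n, F n 0 = 0) (t : ℝ) :
    F 0 t = 0 := by
  rcases le_total 0 t with ht | ht
  · exact eq_zero_of_denjoyCarleman hF hM hMF hconv hdiv h0 ht
  · have hneg : ∀ n s, HasDerivAt (fun s => (-1 : ℝ) ^ n • F n (-s))
        ((-1 : ℝ) ^ (n + 1) • F (n + 1) (-s)) s := fun n s => by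
      have h := ((hF n (-s)).scomp s (hasDerivAt_neg s)).const_smul ((-1 : ℝ) ^ n)
      rw [smul_smul, ← pow_succ] at h
      exact h
    have := eq_zero_of_denjoyCarleman (F := fun n s => (-1 : ℝ) ^ n • F n (-s)) hneg hM
      (fun n s => by simpa [norm_smul] using hMF n (-s)) hconv hdiv (fun n => by simp [h0])
      (neg_nonneg.2 ht)
    simpa using this

end Bang

/-! ### Carleman's criterion for the moment problems of Hamburger and Stieltjes -/

theorem integrable_abs_pow_of_integrable_pow {μ : Measure ℝ} {k : ℕ}
    (h : Integrable (fun x : ℝ => x ^ k) μ) : Integrable (fun x : ℝ => |x| ^ k) μ := by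
  simpa [abs_pow] using h.abs

theorem memLp_id_of_integrable_pow {μ : Measure ℝ} [IsFiniteMeasure μ] {k : ℕ}
    (h : Integrable (fun x : ℝ => x ^ k) μ) : MemLp id k μ := by
  rcases Nat.eq_zero_or_pos k with rfl | hk
  · simpa using by fun_prop
  · rw [← integrable_norm_rpow_iff aestronglyMeasurable_id (by exact_mod_cast hk.ne') (by simp)]
    simpa using integrable_abs_pow_of_integrable_pow h

/-- The quadratic form expressing the log-convexity of absolute moments is nonnegative. -/
theorem quadratic_integral_abs_pow_nonneg {μ : Measure ℝ} (h : ∀ k : ℕ, Integrable (fun x : ℝ => x ^ k) μ)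
    (s t : ℝ) (n : ℕ) :
    0 ≤ s ^ 2 * ∫ x, |x| ^ n ∂μ - 2 * s * t * ∫ x, |x| ^ (n + 1) ∂μ +
      t ^ 2 * ∫ x, |x| ^ (n + 2) ∂μ := by
  have hi := fun k => integrable_abs_pow_of_integrable_pow (h k)
  have h1 : 0 ≤ ∫ x, |x| ^ n * (s - t * |x|) ^ 2 ∂μ := integral_nonneg fun x => by positivity
  have h2 : (fun x : ℝ => |x| ^ n * (s - t * |x|) ^ 2) = fun x => s ^ 2 * |x| ^ n -
      2 * s * t * |x| ^ (n + 1) + t ^ 2 * |x| ^ (n + 2) := by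
    ext x
    ring
  rwa [h2, integral_add (f := fun x : ℝ => s ^ 2 * |x| ^ n - 2 * s * t * |x| ^ (n + 1))
      (((hi n).const_mul _).sub ((hi _).const_mul _)) ((hi _).const_mul _),
    integral_sub ((hi n).const_mul _) ((hi _).const_mul _), integral_const_mul,
    integral_const_mul, integral_const_mul] at h1

theorem sq_le_mul_of_quadratic_nonneg {A B C : ℝ} (hA : 0 < A)
    (h : ∀ s t : ℝ, 0 ≤ s ^ 2 * A - 2 * s * t * B + t ^ 2 * C) : B ^ 2 ≤ A * C := by
  have := h B A
  have h2 : 0 ≤ A * (A * C - B ^ 2) := by nlinarith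
  linarith [nonneg_of_mul_nonneg_right h2 hA]

/-- Differentiation under the integral brings down `(i x) ^ n`, and the exponential has modulus one.
-/
theorem norm_iteratedDeriv_charFun_le {μ : Measure ℝ} [IsFiniteMeasure μ] {n : ℕ}
    (h : Integrable (fun x : ℝ => x ^ n) μ) (t : ℝ) :
    ‖iteratedDeriv n (charFun μ) t‖ ≤ ∫ x, |x| ^ n ∂μ := by
  rw [iteratedDeriv_charFun (memLp_id_of_integrable_pow h), norm_mul, norm_pow, Complex.norm_I,
    one_pow, one_mul]
  refine (norm_integral_le_integral_norm _).trans_eq (integral_congr_ae (ae_of_all _ fun x => ?_))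
  have : ‖Complex.exp (t * x * Complex.I)‖ = 1 := by
    rw [← Complex.ofReal_mul, Complex.norm_exp_ofReal_mul_I]
  simp [this]

/-- **Carleman's criterion** for the Hamburger moment problem. -/
theorem MeasureTheory.Measure.ext_of_moments_of_carleman {μ ν : Measure ℝ} [IsFiniteMeasure μ]
    [IsFiniteMeasure ν] (hμ : ∀ k : ℕ, Integrable (fun x : ℝ => x ^ k) μ)
    (hν : ∀ k : ℕ, Integrable (fun x : ℝ => x ^ k) ν)
    (hmom : ∀ k : ℕ, ∫ x, x ^ k ∂μ = ∫ x, x ^ k ∂ν)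
    (hC : ¬ Summable fun k : ℕ => (∫ x, x ^ (2 * (k + 1)) ∂μ) ^ (-(1 / (2 * ((k : ℝ) + 1))))) :
    μ = ν := by
  set M : ℕ → ℝ := fun n => ∫ x, |x| ^ n ∂μ + ∫ x, |x| ^ n ∂ν with hM
  have hnn : ∀ (ρ : Measure ℝ) (n : ℕ), 0 ≤ ∫ x, |x| ^ n ∂ρ := fun ρ n =>
    integral_nonneg fun x => by positivity
  have hpos : ∀ n, 0 < M n := by
    intro n
    by_contra hn
    have h0 : ∫ x, |x| ^ n ∂μ = 0 := by
      have := hnn μ n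
      have := hnn ν n
      simp only [hM] at hn
      linarith
    rw [integral_eq_zero_iff_of_nonneg (fun x => by positivity)
      (integrable_abs_pow_of_integrable_pow (hμ n))] at h0
    -- A vanishing `M n` would put all mass of `μ` at `0`. A negative real power of `0` is `0` in
    -- Lean, so the series in `hC` would be identically zero, hence summable.
    refine hC (summable_zero.congr fun k => ?_)
    have h1 : ∫ x, x ^ (2 * (k + 1)) ∂μ = 0 := by
      refine integral_eq_zero_of_ae ?_
      filter_upwards [h0] with x hx
      have : x = 0 := abs_eq_zero.1 (eq_zero_of_pow_eq_zero hx)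
      simp [this]
    rw [h1, Real.zero_rpow]
    exact neg_ne_zero.2 (by positivity)
  -- Log-convexity is used as nonnegativity of a quadratic form because such forms for `μ` and `ν`
  -- simply add.
  have hconv : ∀ n, M (n + 1) ^ 2 ≤ M n * M (n + 2) := fun n =>
    sq_le_mul_of_quadratic_nonneg (hpos n) fun s t => by
      have h1 := quadratic_integral_abs_pow_nonneg hμ s t n
      have h2 := quadratic_integral_abs_pow_nonneg hν s t n
      simp only [hM]
      linarith
  have heven : ∀ k : ℕ, M (2 * (k + 1)) = 2 * ∫ x, x ^ (2 * (k + 1)) ∂μ := by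
    intro k
    simp only [hM, (even_two_mul (k + 1)).pow_abs, ← hmom]
    ring
  have hdiv : ¬ Summable fun n => M n / M (n + 1) := by
    intro hs
    -- Keeping only the even orders `2 (k + 1)` removes the absolute values. There `M` is twice the
    -- moment of `μ`, and the extra factor `2` below compensates for this.
    have h1 := (summable_rpow_neg_inv_of_summable_ratio hpos hs).comp_injective
      (i := fun k : ℕ => 2 * k + 1) (fun _ _ h => by simpa using h)
    refine hC ((h1.mul_left 2).of_nonneg_of_le (fun k => ?_) fun k => ?_)
    · refine Real.rpow_nonneg (integral_nonneg fun x => (even_two_mul (k + 1)).pow_nonneg x) _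
    · have hk : (0 : ℝ) < 2 * ((k : ℝ) + 1) := by positivity
      have h2 : ((2 * k + 1 : ℕ) : ℝ) + 1 = 2 * ((k : ℝ) + 1) := by push_cast; ring
      have h3 : 2 * k + 1 + 1 = 2 * (k + 1) := by ring
      simp only [Function.comp_apply, h2, h3, heven]
      rw [Real.mul_rpow zero_le_two
        (integral_nonneg fun x => (even_two_mul (k + 1)).pow_nonneg x), ← mul_assoc]
      refine le_mul_of_one_le_left
        (Real.rpow_nonneg (integral_nonneg fun x => (even_two_mul (k + 1)).pow_nonneg x) _) ?_
      nth_rewrite 1 [← Real.rpow_one 2]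
      rw [← Real.rpow_add zero_lt_two]
      refine Real.one_le_rpow one_le_two ?_
      rw [← sub_eq_add_neg, sub_nonneg, div_le_one hk]
      linarith [Nat.cast_nonneg (α := ℝ) k]
  have hsmooth : ∀ (ρ : Measure ℝ) [IsFiniteMeasure ρ],
      (∀ k : ℕ, Integrable (fun x : ℝ => x ^ k) ρ) → ∀ n t, HasDerivAt
        (iteratedDeriv n (charFun ρ)) (iteratedDeriv (n + 1) (charFun ρ) t) t := by
    intro ρ _ hρ n t
    rw [iteratedDeriv_succ]
    exact ((contDiff_charFun (memLp_id_of_integrable_pow (hρ (n + 1)))).differentiable_iteratedDeriv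
      n (by exact_mod_cast n.lt_succ_self) t).hasDerivAt
  refine Measure.ext_of_charFun (funext fun t => sub_eq_zero.1 ?_)
  have := eq_zero_of_denjoyCarleman_real
    (F := fun n t => iteratedDeriv n (charFun μ) t - iteratedDeriv n (charFun ν) t) (M := M)
    (fun n t => (hsmooth μ hμ n t).sub (hsmooth ν hν n t)) hpos
    (fun n t => (norm_sub_le _ _).trans (add_le_add (norm_iteratedDeriv_charFun_le (hμ n) t)
      (norm_iteratedDeriv_charFun_le (hν n) t))) hconv hdiv
    (fun n => by
      rw [iteratedDeriv_charFun_zero (memLp_id_of_integrable_pow (hμ n)),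
        iteratedDeriv_charFun_zero (memLp_id_of_integrable_pow (hν n)), hmom, sub_self]) t
  simpa using this

/-- The symmetric measure on the line whose image under squaring is `2 ν`, for `ν` on `[0, ∞)`. -/
noncomputable def symmSqrt (ν : Measure ℝ) : Measure ℝ :=
  ν.map Real.sqrt + ν.map fun x => -Real.sqrt x

theorem measurable_neg_sqrt : Measurable fun x : ℝ => -Real.sqrt x :=
  Real.continuous_sqrt.measurable.neg

instance symmSqrt.instIsFiniteMeasure (ν : Measure ℝ) [IsFiniteMeasure ν] :
    IsFiniteMeasure (symmSqrt ν) := by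
  unfold symmSqrt
  infer_instance

theorem integrable_sqrt_pow {ν : Measure ℝ} [IsFiniteMeasure ν] (h0 : ν (Set.Iio 0) = 0) {k : ℕ}
    (h : Integrable (fun x : ℝ => x ^ k) ν) : Integrable (fun x : ℝ => Real.sqrt x ^ k) ν := by
  refine ((integrable_const (1 : ℝ)).add h).mono'
    (Real.continuous_sqrt.pow k).aestronglyMeasurable ?_
  have h0' : ∀ᵐ x ∂ν, 0 ≤ x := by
    rw [ae_iff]
    simpa [Set.Iio] using h0
  filter_upwards [h0'] with x hx
  rw [Real.norm_of_nonneg (by positivity)]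
  rcases le_total x 1 with h1 | h1
  · exact (pow_le_one₀ (Real.sqrt_nonneg x) (Real.sqrt_le_one.2 h1)).trans
      (le_add_of_nonneg_right (pow_nonneg hx k))
  · refine (pow_le_pow_left₀ (Real.sqrt_nonneg x) ?_ k).trans
      (le_add_of_nonneg_left zero_le_one)
    rw [Real.sqrt_le_left hx]
    nlinarith

theorem integrable_pow_symmSqrt {ν : Measure ℝ} [IsFiniteMeasure ν] (h0 : ν (Set.Iio 0) = 0)
    {k : ℕ} (h : Integrable (fun x : ℝ => x ^ k) ν) :
    Integrable (fun x : ℝ => x ^ k) (symmSqrt ν) := by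
  have hc : ∀ ρ : Measure ℝ, AEStronglyMeasurable (fun x : ℝ => x ^ k) ρ := fun ρ =>
    (continuous_pow k).aestronglyMeasurable
  refine Integrable.add_measure ?_ ?_
  · rw [integrable_map_measure (hc _) Real.continuous_sqrt.measurable.aemeasurable]
    exact integrable_sqrt_pow h0 h
  · rw [integrable_map_measure (hc _) measurable_neg_sqrt.aemeasurable]
    refine ((integrable_sqrt_pow h0 h).const_mul ((-1) ^ k)).congr (ae_of_all _ fun x => ?_)
    simp only [Function.comp_apply]
    rw [← neg_one_mul (Real.sqrt x), mul_pow]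

theorem integral_pow_symmSqrt {ν : Measure ℝ} [IsFiniteMeasure ν] (h0 : ν (Set.Iio 0) = 0)
    {k : ℕ} (h : Integrable (fun x : ℝ => x ^ k) ν) :
    ∫ x, x ^ k ∂(symmSqrt ν) = (1 + (-1) ^ k) * ∫ x, Real.sqrt x ^ k ∂ν := by
  have hc : ∀ ρ : Measure ℝ, AEStronglyMeasurable (fun x : ℝ => x ^ k) ρ := fun ρ =>
    (continuous_pow k).aestronglyMeasurable
  have hi := integrable_pow_symmSqrt h0 h
  rw [symmSqrt, integrable_add_measure] at hi
  rw [symmSqrt, integral_add_measure hi.1 hi.2,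
    integral_map Real.continuous_sqrt.measurable.aemeasurable (hc _),
    integral_map measurable_neg_sqrt.aemeasurable (hc _), add_mul, one_mul, ← integral_const_mul]
  congr 2
  ext x
  rw [← neg_one_mul (Real.sqrt x), mul_pow]

theorem integral_even_pow_symmSqrt {ν : Measure ℝ} [IsFiniteMeasure ν] (h0 : ν (Set.Iio 0) = 0)
    (h : ∀ k : ℕ, Integrable (fun x : ℝ => x ^ k) ν) (k : ℕ) :
    ∫ x, x ^ (2 * k) ∂(symmSqrt ν) = 2 * ∫ x, x ^ k ∂ν := by
  rw [integral_pow_symmSqrt h0 (h _), (even_two_mul k).neg_one_pow, one_add_one_eq_two]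
  congr 1
  have h0' : ∀ᵐ x ∂ν, 0 ≤ x := by
    rw [ae_iff]
    simpa [Set.Iio] using h0
  refine integral_congr_ae ?_
  filter_upwards [h0'] with x hx
  rw [pow_mul, Real.sq_sqrt hx]

theorem integral_odd_pow_symmSqrt {ν : Measure ℝ} [IsFiniteMeasure ν] (h0 : ν (Set.Iio 0) = 0)
    (h : ∀ k : ℕ, Integrable (fun x : ℝ => x ^ k) ν) {k : ℕ} (hk : Odd k) :
    ∫ x, x ^ k ∂(symmSqrt ν) = 0 := by
  rw [integral_pow_symmSqrt h0 (h _), hk.neg_one_pow]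
  simp

/-- Squaring undoes both branches of the square root, so `ν` can be recovered from its
symmetrisation. -/
theorem map_sq_symmSqrt {ν : Measure ℝ} (h0 : ν (Set.Iio 0) = 0) :
    (symmSqrt ν).map (fun x => x ^ 2) = ν + ν := by
  have hsq : Measurable fun x : ℝ => x ^ 2 := (continuous_pow 2).measurable
  have h0' : ∀ᵐ x ∂ν, 0 ≤ x := by
    rw [ae_iff]
    simpa [Set.Iio] using h0
  rw [symmSqrt, Measure.map_add _ _ hsq, Measure.map_map hsq Real.continuous_sqrt.measurable,
    Measure.map_map hsq measurable_neg_sqrt]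
  have h1 : ν.map ((fun x : ℝ => x ^ 2) ∘ Real.sqrt) = ν := by
    conv_rhs => rw [← Measure.map_id (μ := ν)]
    refine Measure.map_congr ?_
    filter_upwards [h0'] with x hx
    simp [Real.sq_sqrt hx]
  have h2 : ν.map ((fun x : ℝ => x ^ 2) ∘ fun x => -Real.sqrt x) = ν := by
    conv_rhs => rw [← Measure.map_id (μ := ν)]
    refine Measure.map_congr ?_
    filter_upwards [h0'] with x hx
    simp [Real.sq_sqrt hx]
  rw [h1, h2]

/-- **Carleman's criterion** for the Stieltjes moment problem. -/
theorem MeasureTheory.Measure.ext_of_moments_of_carleman_stieltjes {μ ν : Measure ℝ}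
    [IsFiniteMeasure μ] [IsFiniteMeasure ν] (hμ0 : μ (Set.Iio 0) = 0) (hν0 : ν (Set.Iio 0) = 0)
    (hμ : ∀ k : ℕ, Integrable (fun x : ℝ => x ^ k) μ)
    (hν : ∀ k : ℕ, Integrable (fun x : ℝ => x ^ k) ν)
    (hmom : ∀ k : ℕ, ∫ x, x ^ k ∂μ = ∫ x, x ^ k ∂ν)
    (hC : ¬ Summable fun k : ℕ => (∫ x, x ^ (k + 1) ∂μ) ^ (-(1 / (2 * ((k : ℝ) + 1))))) :
    μ = ν := by
  have hnn : ∀ k : ℕ, 0 ≤ ∫ x, x ^ k ∂μ := fun k => by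
    have := integral_even_pow_symmSqrt hμ0 hμ k
    have h2 : 0 ≤ ∫ x, x ^ (2 * k) ∂(symmSqrt μ) :=
      integral_nonneg fun x => (even_two_mul k).pow_nonneg x
    linarith
  have hs : symmSqrt μ = symmSqrt ν := by
    refine Measure.ext_of_moments_of_carleman (fun k => integrable_pow_symmSqrt hμ0 (hμ k))
      (fun k => integrable_pow_symmSqrt hν0 (hν k)) (fun k => ?_) fun hsum => hC ?_
    · rcases Nat.even_or_odd' k with ⟨j, rfl | rfl⟩
      · rw [integral_even_pow_symmSqrt hμ0 hμ, integral_even_pow_symmSqrt hν0 hν, hmom]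
      · rw [integral_odd_pow_symmSqrt hμ0 hμ (odd_two_mul_add_one j),
          integral_odd_pow_symmSqrt hν0 hν (odd_two_mul_add_one j)]
    · refine (hsum.mul_left 2).of_nonneg_of_le (fun k => Real.rpow_nonneg (hnn _) _) fun k => ?_
      have hk : (0 : ℝ) < 2 * ((k : ℝ) + 1) := by positivity
      rw [integral_even_pow_symmSqrt hμ0 hμ, Real.mul_rpow zero_le_two (hnn _), ← mul_assoc]
      refine le_mul_of_one_le_left (Real.rpow_nonneg (hnn _) _) ?_
      nth_rewrite 1 [← Real.rpow_one 2]
      rw [← Real.rpow_add zero_lt_two]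
      refine Real.one_le_rpow one_le_two ?_
      rw [← sub_eq_add_neg, sub_nonneg, div_le_one hk]
      linarith [Nat.cast_nonneg (α := ℝ) k]
  have h2 : μ + μ = ν + ν := by rw [← map_sq_symmSqrt hμ0, hs, map_sq_symmSqrt hν0]
  ext s _
  have h3 : μ s + μ s = ν s + ν s := by
    simpa using congrArg (fun ρ : Measure ℝ => ρ s) h2
  rw [← two_mul, ← two_mul] at h3
  exact (ENNReal.mul_right_inj two_ne_zero ENNReal.ofNat_ne_top).1 h3

/-- Carleman's condition implies determinacy in the Stieltjes moment problem. -/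
theorem StieltjesCarleman.stieltjesMDeterminate {Ω : Type*} [MeasurableSpace Ω] {X : Ω → ℝ}
    {P : Measure Ω} [IsProbabilityMeasure P] (hX : AEMeasurable X P) (h : StieltjesCarleman X P)
    (hpos : ∀ k : ℕ, 0 < moment X k P) : StieltjesMDeterminate (P.map X) := by
  have hc : ∀ k : ℕ, AEStronglyMeasurable (fun x : ℝ => x ^ k) (P.map X) := fun k =>
    (continuous_pow k).aestronglyMeasurable
  have : IsProbabilityMeasure (P.map X) := Measure.isProbabilityMeasure_map hX
  have h0 : P.map X (Set.Iio 0) = 0 := by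
    rw [Measure.map_apply_of_aemeasurable hX measurableSet_Iio]
    have := h.nonneg
    rw [ae_iff] at this
    simpa [Set.preimage] using this
  have hint : ∀ k : ℕ, Integrable (fun x : ℝ => x ^ k) (P.map X) := fun k =>
    (integrable_map_measure (hc k) hX).2 (h.integrable k)
  have hmom : ∀ k : ℕ, ∫ x, x ^ k ∂(P.map X) = moment X k P := fun k =>
    integral_map hX (hc k)
  refine ⟨h0, hint, fun ν hν hν0 hνint hνmom => ?_⟩
  refine (Measure.ext_of_moments_of_carleman_stieltjes h0 hν0 hint hνint (fun k => ?_)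
    fun hs => ?_).symm
  · rcases Nat.eq_zero_or_pos k with rfl | hk
    · simp
    · exact (hνmom k hk).symm
  · refine hs.tsum_ofReal_ne_top ?_
    rw [← h.sum_eq_top]
    refine tsum_congr fun k => ?_
    -- Positivity matters: a negative power of `0` is `∞` in `ℝ≥0∞` but `0` in `ℝ`.
    rw [hmom, ENNReal.ofReal_rpow_of_pos (hpos _)]

/-! ### Divergence of the logarithmic integral -/

theorem lintegral_Ioi_one_div_sq {b : ℝ} (hb : 0 < b) :
    ∫⁻ x in Set.Ioi b, ENNReal.ofReal (1 / x ^ 2) = ENNReal.ofReal (1 / b) := by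
  have h1 : Set.EqOn (fun x : ℝ => x ^ (-2 : ℝ)) (fun x => 1 / x ^ 2) (Set.Ioi b) := fun x hx => by
    have hx0 : 0 < x := hb.trans hx
    simp only
    rw [Real.rpow_neg hx0.le, one_div]
    norm_cast
  have h2 := (integrableOn_Ioi_rpow_of_lt (a := -2) (by norm_num) hb).congr_fun h1
    measurableSet_Ioi
  rw [← ofReal_integral_eq_lintegral_ofReal h2 (ae_of_all _ fun x => by positivity),
    ← setIntegral_congr_fun measurableSet_Ioi h1, integral_Ioi_rpow_of_lt (by norm_num) hb]
  congr 1
  norm_num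
  rw [Real.rpow_neg_one]

/-- If the integrals `∫_a^R φ` tend to infinity, then so does the integral of the positive part. -/
theorem lintegral_Ioi_eq_top_of_tendsto {φ : ℝ → ℝ} {a : ℝ}
    (h : Tendsto (fun R : ℝ => ∫ x in a..R, φ x) atTop atTop) :
    ∫⁻ x in Set.Ioi a, ENNReal.ofReal (φ x) = ⊤ := by
  by_contra hfin
  obtain ⟨R, hR, haR⟩ := ((h.eventually_gt_atTop
    (∫⁻ x in Set.Ioi a, ENNReal.ofReal (φ x)).toReal).and (eventually_ge_atTop a)).exists
  refine absurd hR (not_lt.2 ?_)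
  rw [intervalIntegral.integral_of_le haR]
  by_cases hi : IntegrableOn φ (Set.Ioc a R)
  · rw [integral_eq_lintegral_pos_part_sub_lintegral_neg_part hi]
    refine (sub_le_self _ ENNReal.toReal_nonneg).trans (ENNReal.toReal_mono hfin ?_)
    exact lintegral_mono_set Set.Ioc_subset_Ioi_self
  -- Without integrability the integral takes the default value `0`, which still satisfies the
  -- bound.
  · rw [integral_undef hi]
    exact ENNReal.toReal_nonneg

/-- A real number is controlled by the number of integers below it. -/
theorem ofReal_le_tsum_indicator {y : ℝ} {p : ℕ → Prop} (hp : ∀ k : ℕ, (k : ℝ) + 3 ≤ y → p k) :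
    ENNReal.ofReal y ≤ 4 + ∑' k, {k | p k}.indicator (fun _ => (1 : ℝ≥0∞)) k := by
  rcases le_or_gt y 0 with hy | hy
  · simp [ENNReal.ofReal_of_nonpos hy]
  set N := ⌊y⌋₊
  -- The constant `4` is `3` for the offset of the levels plus `1` for the floor.
  have h1 : ((N - 3 : ℕ) : ℝ≥0∞) ≤ ∑' k, {k | p k}.indicator (fun _ => (1 : ℝ≥0∞)) k := by
    refine le_trans (le_of_eq ?_) (ENNReal.sum_le_tsum (Finset.range (N - 3)))
    rw [Finset.sum_congr rfl (g := fun _ => (1 : ℝ≥0∞)) fun k hk => ?_]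
    · simp
    · refine Set.indicator_of_mem (hp k ?_) _
      have : k + 3 ≤ N := by
        have := Finset.mem_range.1 hk
        omega
      calc (k : ℝ) + 3 = ((k + 3 : ℕ) : ℝ) := by push_cast; ring
        _ ≤ N := by exact_mod_cast this
        _ ≤ y := Nat.floor_le hy.le
  calc ENNReal.ofReal y ≤ ENNReal.ofReal ((4 + (N - 3 : ℕ) : ℕ) : ℝ) := by
        refine ENNReal.ofReal_le_ofReal ((Nat.lt_floor_add_one y).le.trans ?_)
        have : N + 1 ≤ 4 + (N - 3) := by omega
        exact_mod_cast this
    _ = 4 + ((N - 3 : ℕ) : ℝ≥0∞) := by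
        rw [ENNReal.ofReal_natCast]
        push_cast
        rfl
    _ ≤ _ := by gcongr

/-- The first passage points `s k` of `x ↦ U (x ^ 2)` over the levels `k + 3` have a divergent sum of
reciprocals if `∫ U (x ^ 2) / x ^ 2` diverges. -/
theorem exists_passage_seq {U : ℝ → ℝ} {a : ℝ} (ha : 1 < a) (hmono : MonotoneOn U (Set.Ici a))
    (htop : Tendsto U atTop atTop)
    (hdiv : ∫⁻ x in Set.Ioi a, ENNReal.ofReal (U (x ^ 2)) * ENNReal.ofReal (1 / x ^ 2) = ⊤) :
    ∃ s : ℕ → ℝ, (∀ k, a ≤ s k) ∧ (∀ (k : ℕ) x, s k < x → (k : ℝ) + 3 ≤ U (x ^ 2)) ∧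
      ¬ Summable fun k => 1 / s k := by
  -- `U` need not be continuous, so the infimum of `T k` may fail to reach the level; the bound is
  -- claimed only strictly beyond it.
  set T : ℕ → Set ℝ := fun k => {x | a ≤ x ∧ (k : ℝ) + 3 ≤ U (x ^ 2)} with hT
  have hne : ∀ k, (T k).Nonempty := fun k =>
    (((eventually_ge_atTop a).and ((htop.comp (tendsto_pow_atTop two_ne_zero)).eventually_ge_atTop
      ((k : ℝ) + 3))).exists)
  have hbdd : ∀ k, BddBelow (T k) := fun k => ⟨a, fun x hx => hx.1⟩
  have has : ∀ k, a ≤ sInf (T k) := fun k => le_csInf (hne k) fun x hx => hx.1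
  refine ⟨fun k => sInf (T k), has, fun k x hx => ?_, fun hsum => ?_⟩
  · obtain ⟨y, hy, hyx⟩ := exists_lt_of_csInf_lt (hne k) hx
    have hya : a ≤ y := hy.1
    refine hy.2.trans (hmono ?_ ?_ ?_)
    · exact hya.trans (by nlinarith)
    · exact (hya.trans hyx.le).trans (by nlinarith)
    · nlinarith
  -- Layer-cake argument: `U (x ^ 2)` is at most `4` plus the number of `k` with `s k ≤ x`. By
  -- Tonelli, level `k` contributes at most the integral of `1 / x ^ 2` over `[s k, ∞)`, which is `1
  -- / s k`.
  · refine absurd hdiv (ne_of_lt ?_)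
    have hJ : Measurable fun x : ℝ => ENNReal.ofReal (1 / x ^ 2) := by fun_prop
    have hI : ∀ k, Measurable ((Set.Ici (sInf (T k))).indicator fun x : ℝ =>
        ENNReal.ofReal (1 / x ^ 2)) := fun k => hJ.indicator measurableSet_Ici
    calc ∫⁻ x in Set.Ioi a, ENNReal.ofReal (U (x ^ 2)) * ENNReal.ofReal (1 / x ^ 2)
        ≤ ∫⁻ x in Set.Ioi a, (4 * ENNReal.ofReal (1 / x ^ 2) +
          ∑' k, (Set.Ici (sInf (T k))).indicator (fun x => ENNReal.ofReal (1 / x ^ 2)) x) := by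
          refine setLIntegral_mono' measurableSet_Ioi fun x hx => ?_
          have h1 := ofReal_le_tsum_indicator (y := U (x ^ 2)) (p := fun k => sInf (T k) ≤ x)
            fun k hk => csInf_le (hbdd k) ⟨le_of_lt hx, hk⟩
          refine (mul_le_mul_left h1 _).trans_eq ?_
          rw [add_mul, ← ENNReal.tsum_mul_right]
          congr 2
          ext k
          by_cases hk : sInf (T k) ≤ x
          · rw [Set.indicator_of_mem (show k ∈ {k | sInf (T k) ≤ x} from hk), one_mul,
              Set.indicator_of_mem (show x ∈ Set.Ici (sInf (T k)) from hk)]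
          · rw [Set.indicator_of_notMem (show k ∉ {k | sInf (T k) ≤ x} from hk), zero_mul,
              Set.indicator_of_notMem (show x ∉ Set.Ici (sInf (T k)) from hk)]
      _ = 4 * ENNReal.ofReal (1 / a) + ∑' k, ∫⁻ x in Set.Ioi a,
          (Set.Ici (sInf (T k))).indicator (fun x => ENNReal.ofReal (1 / x ^ 2)) x := by
          rw [lintegral_add_left (hJ.const_mul 4), lintegral_const_mul _ hJ,
            lintegral_Ioi_one_div_sq (zero_lt_one.trans ha),
            lintegral_tsum fun k => (hI k).aemeasurable]
      _ ≤ 4 * ENNReal.ofReal (1 / a) + ∑' k, ENNReal.ofReal (1 / sInf (T k)) := by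
          gcongr with k
          rw [← lintegral_Ioi_one_div_sq (zero_lt_one.trans (ha.trans_le (has k))),
            Measure.restrict_congr_set (Ioi_ae_eq_Ici (a := sInf (T k))),
            ← lintegral_indicator measurableSet_Ici]
          exact setLIntegral_le_lintegral _ _
      _ < ⊤ := ENNReal.add_lt_top.2
          ⟨ENNReal.mul_lt_top (by simp) ENNReal.ofReal_lt_top, hsum.tsum_ofReal_ne_top.lt_top⟩

/-! ### Moments of densities on the half-line -/

namespace HasHalfLineDensity

variable {Ω : Type*} [MeasurableSpace Ω] {X : Ω → ℝ} {f : ℝ → ℝ} {P : Measure Ω}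

theorem aemeasurable_density (h : HasHalfLineDensity X f P) :
    AEMeasurable (fun x => ENNReal.ofReal (f x)) (volume.restrict (Set.Ioi (0 : ℝ))) := by
  have : AEMeasurable f (volume.restrict (Set.Ioi (0 : ℝ))) :=
    (aemeasurable_restrict_iff_comap_subtype measurableSet_Ioi).2 h.measurable.aemeasurable
  exact this.ennreal_ofReal

theorem ae_pos (h : HasHalfLineDensity X f P) : ∀ᵐ ω ∂P, 0 < X ω := by
  rw [h.hasLaw.ae_iff (p := fun x => 0 < x) (measurableSet_setOfPred.1 measurableSet_Ioi)]
  exact withDensity_absolutelyContinuous _ _ (ae_restrict_mem measurableSet_Ioi)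

theorem lintegral_pow (h : HasHalfLineDensity X f P) (k : ℕ) :
    ∫⁻ ω, ENNReal.ofReal (X ω ^ k) ∂P =
      ∫⁻ x in Set.Ioi 0, ENNReal.ofReal (f x) * ENNReal.ofReal (x ^ k) := by
  have hm : Measurable fun x : ℝ => ENNReal.ofReal (x ^ k) := by fun_prop
  rw [h.hasLaw.lintegral_comp hm.aemeasurable,
    lintegral_withDensity_eq_lintegral_mul₀ h.aemeasurable_density hm.aemeasurable]
  rfl

theorem lintegral_density [IsProbabilityMeasure P] (h : HasHalfLineDensity X f P) :
    ∫⁻ x in Set.Ioi 0, ENNReal.ofReal (f x) = 1 := by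
  have := h.lintegral_pow 0
  simpa using this.symm

/-- On `(0, r]` the power is at most `r ^ k` and the density has total mass one. -/
theorem lintegral_pow_le [IsProbabilityMeasure P] (h : HasHalfLineDensity X f P) {r : ℝ}
    (hr : 0 < r) (k : ℕ) :
    ∫⁻ ω, ENNReal.ofReal (X ω ^ k) ∂P ≤ ENNReal.ofReal (r ^ k) +
      ∫⁻ x in Set.Ioi r, ENNReal.ofReal (f x) * ENNReal.ofReal (x ^ k) := by
  rw [h.lintegral_pow, ← Set.Ioc_union_Ioi_eq_Ioi hr.le]
  refine (lintegral_union_le _ _ _).trans ?_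
  gcongr
  calc ∫⁻ x in Set.Ioc 0 r, ENNReal.ofReal (f x) * ENNReal.ofReal (x ^ k)
      ≤ ∫⁻ x in Set.Ioc 0 r, ENNReal.ofReal (f x) * ENNReal.ofReal (r ^ k) := by
        refine setLIntegral_mono' measurableSet_Ioc fun x hx => ?_
        gcongr
        · exact hx.1.le
        · exact hx.2
    _ ≤ ∫⁻ x in Set.Ioi 0, ENNReal.ofReal (f x) * ENNReal.ofReal (r ^ k) :=
        lintegral_mono_set Set.Ioc_subset_Ioi_self
    _ = ENNReal.ofReal (r ^ k) := by
        rw [lintegral_mul_const' _ _ ENNReal.ofReal_ne_top, h.lintegral_density, one_mul]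

/-- Moment bound for a density with a polynomially decaying tail. -/
theorem lintegral_pow_le_of_tail [IsProbabilityMeasure P] (h : HasHalfLineDensity X f P) {r c : ℝ}
    (hr : 1 ≤ r) (hc : 0 ≤ c) {k : ℕ} (hf : ∀ x, r < x → f x ≤ c / x ^ (k + 2)) :
    ∫⁻ ω, ENNReal.ofReal (X ω ^ k) ∂P ≤ ENNReal.ofReal (r ^ k + c) := by
  have hr0 : 0 < r := zero_lt_one.trans_le hr
  refine (h.lintegral_pow_le hr0 k).trans ?_
  rw [ENNReal.ofReal_add (by positivity) hc]
  gcongr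
  -- The decay exponent `k + 2` leaves `c / x ^ 2`, with integral `c / r ≤ c` because `r ≥ 1`.
  calc ∫⁻ x in Set.Ioi r, ENNReal.ofReal (f x) * ENNReal.ofReal (x ^ k)
      ≤ ∫⁻ x in Set.Ioi r, ENNReal.ofReal c * ENNReal.ofReal (1 / x ^ 2) := by
        refine setLIntegral_mono' measurableSet_Ioi fun x hx => ?_
        have hx0 : 0 < x := hr0.trans hx
        rw [← ENNReal.ofReal_mul' (by positivity), ← ENNReal.ofReal_mul hc]
        refine ENNReal.ofReal_le_ofReal ?_
        calc f x * x ^ k ≤ c / x ^ (k + 2) * x ^ k := by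
              have := hf x hx
              gcongr
          _ = c * (1 / x ^ 2) := by
              field_simp
              ring
    _ = ENNReal.ofReal c * ENNReal.ofReal (1 / r) := by
        rw [lintegral_const_mul' _ _ ENNReal.ofReal_ne_top, lintegral_Ioi_one_div_sq hr0]
    _ ≤ ENNReal.ofReal c * 1 := by
        gcongr
        rw [ENNReal.ofReal_le_one]
        exact (div_le_one hr0).2 hr
    _ = ENNReal.ofReal c := mul_one _

theorem integrable_pow (h : HasHalfLineDensity X f P) {k : ℕ}
    (hfin : ∫⁻ ω, ENNReal.ofReal (X ω ^ k) ∂P ≠ ⊤) : Integrable (fun ω => X ω ^ k) P := by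
  have hm : AEStronglyMeasurable (fun ω => X ω ^ k) P :=
    (h.hasLaw.aemeasurable.pow_const k).aestronglyMeasurable
  refine ⟨hm, ?_⟩
  rw [hasFiniteIntegral_iff_ofReal]
  · exact hfin.lt_top
  · filter_upwards [h.ae_pos] with ω hω
    exact pow_nonneg hω.le k

theorem moment_eq (h : HasHalfLineDensity X f P) (k : ℕ) :
    moment X k P = (∫⁻ ω, ENNReal.ofReal (X ω ^ k) ∂P).toReal := by
  rw [moment_def]
  refine integral_eq_lintegral_of_nonneg_ae ?_
    (h.hasLaw.aemeasurable.pow_const k).aestronglyMeasurable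
  filter_upwards [h.ae_pos] with ω hω
  exact pow_nonneg hω.le k

theorem moment_pos [IsProbabilityMeasure P] (h : HasHalfLineDensity X f P) {k : ℕ}
    (hint : Integrable (fun ω => X ω ^ k) P) : 0 < moment X k P := by
  have hnn : 0 ≤ᵐ[P] fun ω => X ω ^ k := by
    filter_upwards [h.ae_pos] with ω hω
    exact pow_nonneg hω.le k
  refine lt_of_le_of_ne (integral_nonneg_of_ae hnn) fun h0 => ?_
  have h1 := (integral_eq_zero_iff_of_nonneg_ae hnn hint).1 h0.symm
  obtain ⟨ω, h2, h3⟩ := (h1.and h.ae_pos).exists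
  exact (pow_pos h3 k).ne' h2

end HasHalfLineDensity

/-- Take roots of order `n`, with `C ^ (1/n) ≤ C` since `C ≥ 1`. This turns a moment bound into a
lower bound for a Carleman term. -/
theorem le_rpow_neg_of_pow_le {m s C : ℝ} (hm : 0 < m) (hs : 0 < s) (hC : 1 ≤ C) {n : ℕ}
    (hn : 0 < n) (h : m ≤ C * s ^ n) : C⁻¹ * (1 / s) ≤ m ^ (-(1 / (n : ℝ))) := by
  have hn' : (1 : ℝ) ≤ n := by exact_mod_cast hn
  have hC0 : 0 < C := zero_lt_one.trans_le hC
  have h1 : m ^ (1 / (n : ℝ)) ≤ C * s := by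
    calc m ^ (1 / (n : ℝ)) ≤ (C * s ^ n) ^ (1 / (n : ℝ)) :=
          Real.rpow_le_rpow hm.le h (by positivity)
      _ = C ^ (1 / (n : ℝ)) * s := by
          rw [Real.mul_rpow hC0.le (by positivity), ← Real.rpow_natCast, ← Real.rpow_mul hs.le,
            mul_one_div_cancel (by positivity), Real.rpow_one]
      _ ≤ C ^ (1 : ℝ) * s := by
          gcongr
          rw [div_le_one (by positivity)]
          exact hn'
      _ = C * s := by rw [Real.rpow_one]
  rw [Real.rpow_neg hm.le, one_div s, ← mul_inv]
  exact inv_anti₀ (Real.rpow_pos_of_pos hm _) h1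

/-- A density dominated by `c x ^ (-U x)` near infinity, where `U` tends to infinity, has all
moments. -/
theorem HasHalfLineDensity.integrable_pow_of_tail {Ω : Type*} [MeasurableSpace Ω] {X : Ω → ℝ}
    {f : ℝ → ℝ} {P : Measure Ω} [IsProbabilityMeasure P] (h : HasHalfLineDensity X f P)
    {U : ℝ → ℝ} {a c : ℝ} (ha : 1 < a) (hc : 0 ≤ c) (htop : Tendsto U atTop atTop)
    (hf : ∀ x, a ≤ x → ∀ n : ℕ, (n : ℝ) ≤ U x → f x ≤ c / x ^ n) (k : ℕ) :
    Integrable (fun ω => X ω ^ k) P := by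
  obtain ⟨r, hr⟩ := eventually_atTop.1 (htop.eventually_ge_atTop ((k + 2 : ℕ) : ℝ))
  refine h.integrable_pow (ne_top_of_le_ne_top ENNReal.ofReal_ne_top
    (h.lintegral_pow_le_of_tail (r := max a r) (ha.le.trans (le_max_left _ _)) hc fun x hx => ?_))
  exact hf x ((le_max_left _ _).trans hx.le) _ (hr x ((le_max_right _ _).trans hx.le))

/-- Carleman's condition for a density dominated by `c x ^ (-U x)` near infinity, where `U`
increases to infinity and `∫ U (x ^ 2) / x ^ 2` diverges. -/
theorem HasHalfLineDensity.stieltjesCarleman_of_tail {Ω : Type*} [MeasurableSpace Ω] {X : Ω → ℝ}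
    {f : ℝ → ℝ} {P : Measure Ω} [IsProbabilityMeasure P] (h : HasHalfLineDensity X f P)
    {U : ℝ → ℝ} {a c : ℝ} (ha : 1 < a) (hc : 0 ≤ c) (hmono : MonotoneOn U (Set.Ici a))
    (htop : Tendsto U atTop atTop)
    (hdiv : ∫⁻ x in Set.Ioi a, ENNReal.ofReal (U (x ^ 2)) * ENNReal.ofReal (1 / x ^ 2) = ⊤)
    (hf : ∀ x, a ≤ x → ∀ n : ℕ, (n : ℝ) ≤ U x → f x ≤ c / x ^ n) : StieltjesCarleman X P := by
  have hint := h.integrable_pow_of_tail ha hc htop hf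
  refine ⟨h.ae_pos.mono fun _ => le_of_lt, hint, ?_⟩
  obtain ⟨s, has, hs, hsum⟩ := exists_passage_seq ha hmono htop hdiv
  have hs1 : ∀ k, 1 < s k := fun k => ha.trans_le (has k)
  have hbound : ∀ k : ℕ, moment X (k + 1) P ≤ (1 + c) * s k ^ (2 * (k + 1)) := by
    intro k
    have h1 : 1 ≤ s k ^ 2 := one_le_pow₀ (hs1 k).le
    -- For `x > s k ^ 2` the passage property at `√x` gives `U x ≥ k + 3 = (k + 1) + 2`, exactly the
    -- decay needed for the moment of order `k + 1`.
    have h2 := h.lintegral_pow_le_of_tail (r := s k ^ 2) (k := k + 1) h1 hc fun x hx => by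
      have hx0 : 0 ≤ x := zero_le_one.trans (h1.trans hx.le)
      have hax : a ≤ x := by nlinarith [has k, hs1 k]
      refine hf x hax _ ?_
      have h3 := hs k (Real.sqrt x) (Real.lt_sqrt_of_sq_lt hx)
      rw [Real.sq_sqrt hx0] at h3
      refine le_trans (le_of_eq ?_) h3
      push_cast
      ring
    rw [h.moment_eq]
    have h3 : (s k ^ 2) ^ (k + 1) = s k ^ (2 * (k + 1)) := (pow_mul _ _ _).symm
    have h4 : 1 ≤ s k ^ (2 * (k + 1)) := one_le_pow₀ (hs1 k).le
    rw [h3] at h2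
    refine (ENNReal.toReal_le_of_le_ofReal (by positivity) h2).trans ?_
    nlinarith
  by_contra hfin
  refine hsum ?_
  have hpos : ∀ k, 0 < moment X k P := fun k => h.moment_pos (hint k)
  have hsum' : Summable fun k : ℕ => (moment X (k + 1) P) ^ (-(1 / (2 * ((k : ℝ) + 1)))) := by
    have h1 := ENNReal.summable_toReal hfin
    refine h1.congr fun k => ?_
    rw [ENNReal.ofReal_rpow_of_pos (hpos _), ENNReal.toReal_ofReal (Real.rpow_nonneg (hpos _).le _)]
  refine (hsum'.mul_left (1 + c)).of_nonneg_of_le (fun k => ?_) fun k => ?_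
  · have := zero_lt_one.trans (hs1 k)
    positivity
  · have h1 := le_rpow_neg_of_pow_le (hpos (k + 1)) (zero_lt_one.trans (hs1 k))
      (le_add_of_nonneg_right hc) (n := 2 * (k + 1)) (by positivity) (hbound k)
    push_cast at h1
    rwa [inv_mul_le_iff₀ (by positivity)] at h1

/-- Comparison of moments for densities dominated near infinity. -/
theorem HasHalfLineDensity.exists_moment_le {Ω Ω' : Type*} [MeasurableSpace Ω]
    [MeasurableSpace Ω'] {P : Measure Ω} [IsProbabilityMeasure P] {P' : Measure Ω'}
    [IsProbabilityMeasure P'] {X : Ω → ℝ} {X' : Ω' → ℝ} {f f' : ℝ → ℝ}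
    (h : HasHalfLineDensity X f P) (h' : HasHalfLineDensity X' f' P') {a c : ℝ} (ha : 0 < a)
    (hc : 0 ≤ c) (hpos : ∀ x, a ≤ x → 0 < f x) (hle : ∀ x, a ≤ x → f' x ≤ c * f x)
    (hint : ∀ k : ℕ, Integrable (fun ω => X ω ^ k) P) :
    ∃ C : ℝ, 0 < C ∧ ∀ n : ℕ, moment X' n P' ≤ C * moment X n P := by
  set p := ∫⁻ x in Set.Ioi a, ENNReal.ofReal (f x) with hp
  have hsub : Set.Ioi a ⊆ Set.Ioi (0 : ℝ) := Set.Ioi_subset_Ioi ha.le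
  have hp1 : p ≤ 1 := (lintegral_mono_set hsub).trans_eq h.lintegral_density
  have hptop : p ≠ ⊤ := ne_top_of_le_ne_top ENNReal.one_ne_top hp1
  have hp0 : p ≠ 0 := by
    intro h0
    rw [hp, lintegral_eq_zero_iff' (h.aemeasurable_density.mono_set hsub)] at h0
    have h1 := h0.and (ae_restrict_mem measurableSet_Ioi)
    have : (ae (volume.restrict (Set.Ioi a))).NeBot := by
      rw [ae_neBot, Ne, Measure.restrict_eq_zero, Real.volume_Ioi]
      exact ENNReal.top_ne_zero
    obtain ⟨x, h2, h3⟩ := h1.exists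
    exact (ENNReal.ofReal_pos.2 (hpos x (le_of_lt h3))).ne' h2
  have hpr : 0 < p.toReal := ENNReal.toReal_pos hp0 hptop
  -- With `p` the mass of `X` beyond `a`, `p a ^ n ≤ E[X ^ n]` and `E[X' ^ n] ≤ a ^ n + c E[X ^ n]`.
  refine ⟨1 / p.toReal + c, by positivity, fun n => ?_⟩
  set L := ∫⁻ ω, ENNReal.ofReal (X ω ^ n) ∂P with hL
  have hLtop : L ≠ ⊤ := (hint n).lintegral_lt_top.ne
  have h1 : p * ENNReal.ofReal (a ^ n) ≤ L := by
    rw [hL, h.lintegral_pow, hp, ← lintegral_mul_const' _ _ ENNReal.ofReal_ne_top]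
    refine le_trans (setLIntegral_mono' measurableSet_Ioi fun x hx => ?_) (lintegral_mono_set hsub)
    have : a ≤ x := le_of_lt hx
    gcongr
  have h2 : ∫⁻ ω, ENNReal.ofReal (X' ω ^ n) ∂P' ≤ ENNReal.ofReal (a ^ n) +
      ENNReal.ofReal c * L := by
    refine (h'.lintegral_pow_le ha n).trans ?_
    gcongr
    rw [hL, h.lintegral_pow, ← lintegral_const_mul' _ _ ENNReal.ofReal_ne_top]
    refine le_trans (setLIntegral_mono' measurableSet_Ioi fun x hx => ?_) (lintegral_mono_set hsub)
    rw [← mul_assoc, ← ENNReal.ofReal_mul hc]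
    gcongr
    exact hle x (le_of_lt hx)
  rw [h.moment_eq, h'.moment_eq, ← hL]
  have h3 : p.toReal * a ^ n ≤ L.toReal := by
    have := ENNReal.toReal_mono hLtop h1
    rwa [ENNReal.toReal_mul, ENNReal.toReal_ofReal (by positivity)] at this
  have h4 := ENNReal.toReal_mono (by finiteness) h2
  rw [ENNReal.toReal_add (by finiteness) (by finiteness), ENNReal.toReal_mul,
    ENNReal.toReal_ofReal (by positivity), ENNReal.toReal_ofReal hc] at h4
  refine h4.trans ?_
  rw [add_mul, one_div, ← div_eq_inv_mul]
  gcongr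
  rwa [le_div_iff₀ hpr, mul_comm]

/-! ### The theorem -/

theorem mul_exp_neg_mul_log_le {c w x : ℝ} (hc : 0 ≤ c) (hx : 1 ≤ x) {n : ℕ} (hn : (n : ℝ) ≤ w) :
    c * Real.exp (-w * Real.log x) ≤ c / x ^ n := by
  have hx0 : 0 < x := zero_lt_one.trans_le hx
  rw [div_eq_mul_inv]
  refine mul_le_mul_of_nonneg_left ?_ hc
  rw [← Real.exp_log (inv_pos.2 (pow_pos hx0 n)), Real.log_inv, Real.log_pow, Real.exp_le_exp]
  nlinarith [Real.log_nonneg hx]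

/-- Since `ln (x ^ 2) = 2 ln x`, the integrand of `KStarDiverges` is twice `U (x ^ 2) / x ^ 2` with
`U = -ln g / ln`, the function assumed monotone. -/
theorem KStarDiverges.lintegral_eq_top {g : ℝ → ℝ} {a : ℝ} (ha : 1 < a) (h : KStarDiverges g a) :
    ∫⁻ x in Set.Ioi a, ENNReal.ofReal (-Real.log (g (x ^ 2)) / Real.log (x ^ 2)) *
      ENNReal.ofReal (1 / x ^ 2) = ⊤ := by
  have h1 := lintegral_Ioi_eq_top_of_tendsto h
  rw [setLIntegral_congr_fun (g := fun x => 2 *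
    (ENNReal.ofReal (-Real.log (g (x ^ 2)) / Real.log (x ^ 2)) * ENNReal.ofReal (1 / x ^ 2)))
    measurableSet_Ioi fun x hx => ?_, lintegral_const_mul' _ _ ENNReal.ofNat_ne_top] at h1
  · by_contra h2
    exact ENNReal.mul_ne_top ENNReal.ofNat_ne_top h2 h1
  · have hx1 : 1 < x := ha.trans hx
    have hlog : Real.log x ≠ 0 := (Real.log_pos hx1).ne'
    simp only
    rw [← ENNReal.ofReal_mul' (by positivity), ← ENNReal.ofReal_ofNat 2,
      ← ENNReal.ofReal_mul zero_le_two, Real.log_pow]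
    congr 1
    push_cast
    field_simp

theorem lemma4 {Ω Ω' : Type*} [MeasurableSpace Ω] [MeasurableSpace Ω']
    (P : Measure Ω) [IsProbabilityMeasure P] (P' : Measure Ω') [IsProbabilityMeasure P']
    (Y : Ω → ℝ) (g u : ℝ → ℝ) (a : ℝ)
    (hY : HasHalfLineDensity Y g P)
    (hg : StieltjesDensityConditions g a)
    (hu : ∀ x : ℝ, a ≤ x → g x = Real.exp (-u x * Real.log x))
    (v : ℝ → ℝ) (hv : Measurable fun x : Set.Ioi (0 : ℝ) => v x)
    (huv : ∀ x : ℝ, a ≤ x → u x ≤ v x)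
    (Ystar : Ω' → ℝ) (c : ℝ) (hc : 0 < c)
    (hYstar : HasHalfLineDensity Ystar (fun x => c * Real.exp (-v x * Real.log x)) P') :
    (∀ n : ℕ, Integrable (fun ω => Y ω ^ n) P) ∧
    (∀ n : ℕ, Integrable (fun ω => Ystar ω ^ n) P') ∧
    (∃ C : ℝ, 0 < C ∧ ∀ n : ℕ, moment Ystar n P' ≤ C * moment Y n P) ∧
    StieltjesCarleman Ystar P' ∧
    StieltjesMDeterminate (P'.map Ystar) := by
  have ha := hg.one_lt
  have hU : ∀ x, a ≤ x → -Real.log (g x) / Real.log x = u x := fun x hx => by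
    have hlog : Real.log x ≠ 0 := (Real.log_pos (ha.trans_le hx)).ne'
    rw [hu x hx, Real.log_exp]
    field_simp
  have htail : ∀ x, a ≤ x → ∀ n : ℕ, (n : ℝ) ≤ -Real.log (g x) / Real.log x →
      g x ≤ 1 / x ^ n := fun x hx n hn => by
    rw [hU x hx] at hn
    rw [hu x hx, ← one_mul (Real.exp _)]
    exact mul_exp_neg_mul_log_le zero_le_one (ha.le.trans hx) hn
  -- The tail of `Y_*` is measured against the exponent of `g` rather than `v`, so monotonicity and
  -- divergence are needed only for `g`.
  have htail' : ∀ x, a ≤ x → ∀ n : ℕ, (n : ℝ) ≤ -Real.log (g x) / Real.log x →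
      c * Real.exp (-v x * Real.log x) ≤ c / x ^ n := fun x hx n hn => by
    rw [hU x hx] at hn
    exact mul_exp_neg_mul_log_le hc.le (ha.le.trans hx) (hn.trans (huv x hx))
  have hint := hY.integrable_pow_of_tail ha zero_le_one hg.tendsto htail
  have hint' := hYstar.integrable_pow_of_tail ha hc.le hg.tendsto htail'
  have hcar := hYstar.stieltjesCarleman_of_tail ha hc.le hg.monotoneOn hg.tendsto
    (hg.kStar.lintegral_eq_top ha) htail'
  refine ⟨hint, hint', hY.exists_moment_le hYstar (zero_lt_one.trans ha) hc.le hg.pos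
    (fun x hx => ?_) hint, hcar,
    hcar.stieltjesMDeterminate hYstar.hasLaw.aemeasurable fun k => hYstar.moment_pos (hint' k)⟩
  rw [hu x hx]
  refine mul_le_mul_of_nonneg_left (Real.exp_le_exp.2 ?_) hc.le
  have := huv x hx
  have := Real.log_nonneg (ha.le.trans hx)
  nlinarith
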